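/- **Setting.** Let $Y,U$ be real Hilbert spaces, $Q\subset\mathbb R^n$ a nonempty bounded polyhedron (finite intersection of closed halfspaces) with nonempty interior, $U_{ad}\subset U$ nonempty, closed and convex, $A\in L[Y,Y^*]$ an isomorphism, $B\in L[U,Y^*]$, and $S:=A^{-1}B$. Let $F,f:Q\times Y\times U\to\mathbb R$ be bounded from below, convex and continuously Fréchet differentiable. Assume that for every $M\ge 0$ there is $L_M\ge 0$ such that for all $\beta,\beta_1,\beta_2\in Q$, all $y_1,y_2\in Y$ with norm at most $M$ and all $u,u_1,u_2\in U_{ad}$ with norm at most $M$ $$\|f'_\beta(\beta_1,y_1,u_1)-f'_\beta(\beta_2,y_2,u_2)\|\le L_M(\|\beta_1-\beta_2\|+\|y_1-y_2\|+\|u_1-u_2\|),$$ $$|F(\beta,y_1,u_1)-F(\beta,y_2,u_2)|\le L_M(\|y_1-y_2\|+\|u_1-u_2\|),$$ $$\|f'_u(\beta_1,Su,u)-f'_u(\beta_2,Su,u)\|\le L_M\|\beta_1-\beta_2\|,\qquad \|f'_y(\beta_1,Su,u)-f'_y(\beta_2,Su,u)\|\le L_M\|\beta_1-\beta_2\|.$$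 Assume also that there is $\mu>0$ such that for all $\beta\in Q$ and $u_1,u_2\in U_{ad}$ $$f(\beta,Su_2,u_2)\ge f(\beta,Su_1,u_1)+\langle f'_y(\beta,Su_1,u_1),S(u_2-u_1)\rangle+\langle f'_u(\beta,Su_1,u_1),u_2-u_1\rangle+\tfrac\mu2\|u_2-u_1\|^2 .$$ Let $\varphi(\beta):=\inf\{f(\beta,y,u): y\in Y,\ u\in U_{ad},\ Ay=Bu\}$ for $\beta\in Q$, and consider the problem $$\text{(OVR)}\qquad \min_{\beta,y,u}F(\beta,y,u)\quad\text{s.t. } \beta\in Q,\ f(\beta,y,u)\le\varphi(\beta),\ Ay-Bu=0,\ u\in U_{ad}.$$ **Algorithm.** For a nondegenerate $n$-simplex $T\subset Q$ let $\xi_T$ be the affine interpolant of $\varphi$ in the vertices of $T$, and $\rho(T):=\operatorname{diam}(B_T)/\operatorname{diam}(T)$ with $B_T$ the largest ball contained in $T$. A subdivision of a set is a finite family of nondegenerate $n$-simplices whose union is the set. Choose a subdivision $\mathcal T_1$ of $Q$ and $q,\rho\in(0,1)$ with $\rho\le\min_{T\in\mathcal T_1}\rho(T)$. In iteration $k=1,2,\dots$: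 * for every $T\in\mathcal T_k$ choose $\gamma_{k,T}>0$ and compute a global minimizer $(\beta_{k,T},y_{k,T},u_{k,T})$ of $F(\beta,y,u)+\gamma_{k,T}\,(f(\beta,y,u)-\xi_T(\beta))$ subject to $\beta\in T$, $Ay-Bu=0$, $u\in U_{ad}$; * select $\bar T_k\in\mathcal T_k$ for which the resulting minimal value is smallest among all $T\in\mathcal T_k$, and put $(\beta_k,y_k,u_k):=(\beta_{k,\bar T_k},y_{k,\bar T_k},u_{k,\bar T_k})$; * construct $\mathcal T_{k+1}$ from $\mathcal T_k$ by replacing $\bar T_k$ with the members of a subdivision of $\bar T_k$ (not containing $\bar T_k$ itself), such that $\operatorname{vol}(T)\le q\operatorname{vol}(\bar T_k)$ and $\rho(T)\ge\rho$ for all $T\in\mathcal T_{k+1}\setminus\mathcal T_k$. The algorithm also has the stopping test $f(\beta_k,y_k,u_k)=\varphi(\beta_k)$ before the refinement; we consider infinite runs, in which the test is never met or is disregarded. **Statement.** Suppose that $\gamma_{k,\bar T_k}\to\infty$ and $\gamma_{k,\bar T_k}\operatorname{diam}(\bar T_k)^2\to0$ as $k\to\infty$. Then $(\beta_k,y_k,u_k)_k$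 contains a subsequence that converges strongly in $\mathbb R^n\times Y\times U$, and all (strong) accumulation points of the sequence are global solutions of (OVR). If (OVR) has a unique global solution $(\bar\beta,\bar y,\bar u)$, then the entire sequence converges strongly to it. -/

import Mathlib

open Set Filter Topology MeasureTheory

noncomputable section

namespace InverseControl

/-- The parameter space `ℝⁿ` with the Euclidean norm. -/
abbrev Param (n : ℕ) : Type := EuclideanSpace ℝ (Fin n)

/-- `Q` is a polyhedron: a finite intersection of closed halfspaces. -/
def IsPolyhedron {n : ℕ} (Q : Set (Param n)) : Prop :=
  ∃ (m : ℕ) (a : Fin m → Param n) (b : Fin m → ℝ),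
    (∀ i, a i ≠ 0) ∧ Q = {x | ∀ i, inner ℝ (a i) x ≤ b i}

/-- The data of the bilevel problem. The functionals are total functions of `(β, y, u)`, but
only their restrictions to `Q × Y × U` are ever used. -/
structure BilevelProblem (n : ℕ) (Y U : Type*)
    [NormedAddCommGroup Y] [InnerProductSpace ℝ Y]
    [NormedAddCommGroup U] [InnerProductSpace ℝ U] where
  /-- the admissible parameters -/
  Q : Set (Param n)
  /-- the admissible controls -/
  Uad : Set U
  /-- the isomorphism from `Y` onto its topological dual -/
  A : Y ≃L[ℝ] StrongDual ℝ Y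
  /-- the control operator -/
  B : U →L[ℝ] StrongDual ℝ Y
  /-- the upper-level objective -/
  F : Param n → Y → U → ℝ
  /-- the lower-level objective -/
  f : Param n → Y → U → ℝ

namespace BilevelProblem

variable {n : ℕ} {Y U : Type*}
  [NormedAddCommGroup Y] [InnerProductSpace ℝ Y]
  [NormedAddCommGroup U] [InnerProductSpace ℝ U]

/-- The control-to-state map `S = A⁻¹ B`. -/
def S (D : BilevelProblem n Y U) : U →L[ℝ] Y :=
  (D.A.symm : StrongDual ℝ Y →L[ℝ] Y).comp D.B

/-- The partial derivative `f'_β` (relative to `Q`, on which `f(·, y, u)` lives). -/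
def fβ (D : BilevelProblem n Y U) (β : Param n) (y : Y) (u : U) : StrongDual ℝ (Param n) :=
  fderivWithin ℝ (fun b => D.f b y u) D.Q β

/-- The partial derivative `f'_y`. -/
def fy (D : BilevelProblem n Y U) (β : Param n) (y : Y) (u : U) : StrongDual ℝ Y :=
  fderiv ℝ (fun y' => D.f β y' u) y

/-- The partial derivative `f'_u`. -/
def fu (D : BilevelProblem n Y U) (β : Param n) (y : Y) (u : U) : StrongDual ℝ U :=
  fderiv ℝ (fun u' => D.f β y u') u

/-- A functional on `Q × Y × U` is bounded from below, convex and continuously Fréchet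
differentiable. (`Q` is convex with nonempty interior, so derivatives relative to
`Q × Y × U` are unique.) -/
structure IsAdmissibleFunctional (Q : Set (Param n)) (G : Param n → Y → U → ℝ) : Prop where
  bounded_below : ∃ c : ℝ, ∀ β ∈ Q, ∀ (y : Y) (u : U), c ≤ G β y u
  convex : ConvexOn ℝ (Q ×ˢ (univ : Set (Y × U))) (fun p => G p.1 p.2.1 p.2.2)
  contDiff : ContDiffOn ℝ 1 (fun p : Param n × Y × U => G p.1 p.2.1 p.2.2)
    (Q ×ˢ (univ : Set (Y × U)))

/-- The standing assumption on the problem data. -/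
structure StandingAssumption (D : BilevelProblem n Y U) : Prop where
  Q_polyhedron : IsPolyhedron D.Q
  Q_nonempty : D.Q.Nonempty
  Q_bounded : Bornology.IsBounded D.Q
  Q_interior : (interior D.Q).Nonempty
  Uad_nonempty : D.Uad.Nonempty
  Uad_closed : IsClosed D.Uad
  Uad_convex : Convex ℝ D.Uad
  F_adm : IsAdmissibleFunctional D.Q D.F
  f_adm : IsAdmissibleFunctional D.Q D.f
  lipschitz : ∀ M : ℝ, 0 ≤ M → ∃ L : ℝ, 0 ≤ L ∧
    ∀ β ∈ D.Q, ∀ β₁ ∈ D.Q, ∀ β₂ ∈ D.Q,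
    ∀ y₁ ∈ Metric.closedBall (0 : Y) M, ∀ y₂ ∈ Metric.closedBall (0 : Y) M,
    ∀ u ∈ D.Uad ∩ Metric.closedBall (0 : U) M,
    ∀ u₁ ∈ D.Uad ∩ Metric.closedBall (0 : U) M,
    ∀ u₂ ∈ D.Uad ∩ Metric.closedBall (0 : U) M,
      ‖D.fβ β₁ y₁ u₁ - D.fβ β₂ y₂ u₂‖ ≤ L * (‖β₁ - β₂‖ + ‖y₁ - y₂‖ + ‖u₁ - u₂‖) ∧
      |D.F β y₁ u₁ - D.F β y₂ u₂| ≤ L * (‖y₁ - y₂‖ + ‖u₁ - u₂‖) ∧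
      ‖D.fu β₁ (D.S u) u - D.fu β₂ (D.S u) u‖ ≤ L * ‖β₁ - β₂‖ ∧
      ‖D.fy β₁ (D.S u) u - D.fy β₂ (D.S u) u‖ ≤ L * ‖β₁ - β₂‖
  strongly_convex : ∃ μ : ℝ, 0 < μ ∧ ∀ β ∈ D.Q, ∀ u₁ ∈ D.Uad, ∀ u₂ ∈ D.Uad,
    D.f β (D.S u₁) u₁ + D.fy β (D.S u₁) u₁ (D.S (u₂ - u₁))
      + D.fu β (D.S u₁) u₁ (u₂ - u₁) + μ / 2 * ‖u₂ - u₁‖ ^ 2 ≤ D.f β (D.S u₂) u₂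

/-- The optimal-value function `φ` of the lower-level problem. -/
def φ (D : BilevelProblem n Y U) (β : Param n) : ℝ :=
  sInf {r : ℝ | ∃ (y : Y) (u : U), u ∈ D.Uad ∧ D.A y = D.B u ∧ r = D.f β y u}

/-- The feasible set of the optimal-value reformulation (OVR). -/
def ovrFeasible (D : BilevelProblem n Y U) : Set (Param n × Y × U) :=
  {x | x.1 ∈ D.Q ∧ D.f x.1 x.2.1 x.2.2 ≤ D.φ x.1 ∧ D.A x.2.1 - D.B x.2.2 = 0 ∧ x.2.2 ∈ D.Uad}

/-- `x = (β, y, u)` is a global solution of (OVR). -/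
def IsOVRSolution (D : BilevelProblem n Y U) (x : Param n × Y × U) : Prop :=
  x ∈ D.ovrFeasible ∧ ∀ x' ∈ D.ovrFeasible, D.F x.1 x.2.1 x.2.2 ≤ D.F x'.1 x'.2.1 x'.2.2

end BilevelProblem

/-- A nondegenerate simplex in `ℝⁿ`, given by its `n + 1` affinely independent vertices. The
associated subset of `ℝⁿ` is `T.closedInterior`, the convex hull of the vertices. -/
abbrev Cell (n : ℕ) : Type := Affine.Simplex ℝ (Param n) n

namespace Cell

variable {n : ℕ}

/-- The vertices of a cell as an affine basis of `ℝⁿ`. -/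
def basis (T : Cell n) : AffineBasis (Fin (n + 1)) ℝ (Param n) where
  toFun := T.points
  ind' := T.independent
  tot' := Affine.Simplex.span_eq_top T finrank_euclideanSpace_fin

/-- The affine function that agrees with `g` at the vertices of `T`. -/
def interpolant (T : Cell n) (g : Param n → ℝ) (β : Param n) : ℝ :=
  ∑ i, (basis T).coord i β * g (T.points i)

/-- The diameter of `T`. -/
def diam (T : Cell n) : ℝ := Metric.diam T.closedInterior

/-- The `n`-dimensional volume of `T`. -/
def vol (T : Cell n) : ℝ := (volume : Measure (Param n)).real T.closedInterior

/-- The aspect ratio `diam B_T / diam T`, with `B_T` the largest ball contained in `T`. -/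
def aspectRatio (T : Cell n) : ℝ :=
  sSup {d : ℝ | ∃ (c : Param n) (r : ℝ), 0 ≤ r ∧ Metric.closedBall c r ⊆ T.closedInterior ∧
    d = Metric.diam (Metric.closedBall c r)} / diam T

end Cell

/-- `𝒯` is a subdivision of `C`: finitely many simplices whose union is `C`. Overlaps and
hanging nodes are allowed. -/
def IsSubdivision {n : ℕ} (𝒯 : Set (Cell n)) (C : Set (Param n)) : Prop :=
  𝒯.Finite ∧ ⋃ T ∈ 𝒯, T.closedInterior = C

namespace BilevelProblem

variable {n : ℕ} {Y U : Type*}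
  [NormedAddCommGroup Y] [InnerProductSpace ℝ Y]
  [NormedAddCommGroup U] [InnerProductSpace ℝ U]

/-- The feasible set of the penalized subproblem on the cell `T`. -/
def penaltyFeasible (D : BilevelProblem n Y U) (T : Cell n) : Set (Param n × Y × U) :=
  {x | x.1 ∈ T.closedInterior ∧ D.A x.2.1 - D.B x.2.2 = 0 ∧ x.2.2 ∈ D.Uad}

/-- The penalized objective `F(β,y,u) + γ P(f(β,y,u) - ξ_T(β))`, where `ξ_T` is the affine
interpolant of `φ` in the vertices of `T`. -/
def penaltyObjective (D : BilevelProblem n Y U) (P : ℝ → ℝ) (T : Cell n) (γ : ℝ)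
    (x : Param n × Y × U) : ℝ :=
  D.F x.1 x.2.1 x.2.2 + γ * P (D.f x.1 x.2.1 x.2.2 - Cell.interpolant T D.φ x.1)

/-- `x` is a global solution of the penalized subproblem on `T` with parameter `γ`. -/
def IsPenaltySolution (D : BilevelProblem n Y U) (P : ℝ → ℝ) (T : Cell n) (γ : ℝ)
    (x : Param n × Y × U) : Prop :=
  x ∈ D.penaltyFeasible T ∧
    ∀ x' ∈ D.penaltyFeasible T, D.penaltyObjective P T γ x ≤ D.penaltyObjective P T γ x'

/-- An infinite run of the penalty algorithm with penalty function `P` and refinement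
parameters `q`, `ρ`; the iterations are numbered from `0`.

* `𝒯 k` is the `k`-th subdivision of `Q`,
* `γ k T` is the penalty parameter used on `T ∈ 𝒯 k` in iteration `k`,
* `z k T` is the computed global solution of the penalized subproblem on `T`,
* `Tbar k` is the selected cell, so that the `k`-th iterate is `z k (Tbar k)`.

The stopping test `f (β_k, y_k, u_k) = φ (β_k)` only decides whether the loop is left. It imposes
nothing here, so that every nonterminating run of the algorithm is covered, and also every
infinite sequence obtained by continuing after the test was met. -/
structure IsPenaltyRun (D : BilevelProblem n Y U) (P : ℝ → ℝ) (q ρ : ℝ)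
    (𝒯 : ℕ → Set (Cell n)) (γ : ℕ → Cell n → ℝ) (z : ℕ → Cell n → Param n × Y × U)
    (Tbar : ℕ → Cell n) : Prop where
  P_mono : Monotone P
  P_zero : P 0 = 0
  q_mem : q ∈ Ioo (0 : ℝ) 1
  ρ_mem : ρ ∈ Ioo (0 : ℝ) 1
  init_subdivision : IsSubdivision (𝒯 0) D.Q
  init_ratio : ∀ T ∈ 𝒯 0, ρ ≤ Cell.aspectRatio T
  γ_pos : ∀ k, ∀ T ∈ 𝒯 k, 0 < γ k T
  solves : ∀ k, ∀ T ∈ 𝒯 k, D.IsPenaltySolution P T (γ k T) (z k T)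
  Tbar_mem : ∀ k, Tbar k ∈ 𝒯 k
  Tbar_argmin : ∀ k, ∀ T ∈ 𝒯 k,
    D.penaltyObjective P (Tbar k) (γ k (Tbar k)) (z k (Tbar k)) ≤
      D.penaltyObjective P T (γ k T) (z k T)
  /-- the selected cell is replaced by the members of a subdivision of it -/
  refine_cell : ∀ k, ∃ R : Set (Cell n), IsSubdivision R (Tbar k).closedInterior ∧
    Tbar k ∉ R ∧ 𝒯 (k + 1) = (𝒯 k \ {Tbar k}) ∪ R
  refine_vol : ∀ k, ∀ T ∈ 𝒯 (k + 1) \ 𝒯 k, Cell.vol T ≤ q * Cell.vol (Tbar k)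
  refine_ratio : ∀ k, ∀ T ∈ 𝒯 (k + 1) \ 𝒯 k, ρ ≤ Cell.aspectRatio T

end BilevelProblem

end InverseControl

end

/-! Strong convexity puts any two controls whose lower-level values are within δ of `φ β` at
distance O(√δ) (`norm_sub_sq_le_of_near_minimizers`). This yields lower-level minimizers without
weak compactness, and strongly convergent subsequences whenever the optimality gap vanishes, since β
ranges over a compact set.

The penalty is controlled by two bounds on the interpolant ξ_T. Convexity of `φ` gives φ ≤ ξ_T on T.
If u minimizes `g β`, then g(·, u) lies above `φ`, touches it at β and has a Lipschitz derivative,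
so ξ_T ≤ φ + C diam(T)² (`exists_interpolant_le`).

By the first bound, (OVR)-feasible points x have nonpositive penalty terms, so the selected minimal
value is at most F(x). By the second, F(z_k) + γ_k (g - φ)(z_k) ≤ F(x) + C γ_k diam²
(`exists_F_add_gap_le`). As F is bounded below and γ_k → ∞, the gap g - φ tends to zero, so limits
are feasible. Dropping the nonnegative gap term gives optimality. -/

namespace InverseControl

/-! ### Affine interpolation on a simplex -/

namespace Cell

variable {n : ℕ}

theorem coord_nonneg {T : Cell n} {β : Param n} (hβ : β ∈ T.closedInterior) (i : Fin (n + 1)) :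
    0 ≤ (basis T).coord i β := by
  rw [← Affine.Simplex.convexHull_eq_closedInterior] at hβ
  have h := (basis T).convexHull_eq_nonneg_coord
  have h' : β ∈ convexHull ℝ (range (basis T)) := hβ
  rw [h] at h'
  exact h' i

theorem sum_coord (T : Cell n) (β : Param n) : ∑ i, (basis T).coord i β = 1 :=
  (basis T).sum_coord_apply_eq_one β

theorem sum_coord_smul_points (T : Cell n) (β : Param n) :
    ∑ i, (basis T).coord i β • T.points i = β :=
  (basis T).linear_combination_coord_eq_self β

theorem norm_points_sub_le_diam {T : Cell n} {β : Param n} (hβ : β ∈ T.closedInterior)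
    (i : Fin (n + 1)) : ‖T.points i - β‖ ≤ diam T := by
  rw [← dist_eq_norm]
  exact Metric.dist_le_diam_of_mem T.isCompact_closedInterior.isBounded
    (T.point_mem_closedInterior i) hβ

/-- A convex function lies below its affine interpolant. -/
theorem le_interpolant {T : Cell n} {s : Set (Param n)} {g : Param n → ℝ} (hg : ConvexOn ℝ s g)
    (hT : T.closedInterior ⊆ s) {β : Param n} (hβ : β ∈ T.closedInterior) :
    g β ≤ interpolant T g β := by
  have h := hg.map_sum_le (t := Finset.univ) (w := fun i => (basis T).coord i β) (p := T.points)
    (fun i _ => coord_nonneg hβ i) (sum_coord T β) (fun i _ => hT (T.point_mem_closedInterior i))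
  rwa [sum_coord_smul_points] at h

/-- An interpolant is at most quadratically above the value of a function with an affine upper
model up to a quadratic error. -/
theorem interpolant_le {T : Cell n} {g : Param n → ℝ} {β : Param n} (hβ : β ∈ T.closedInterior)
    {c C : ℝ} (hC : 0 ≤ C) (ℓ : StrongDual ℝ (Param n))
    (h : ∀ i, g (T.points i) ≤ c + ℓ (T.points i - β) + C * ‖T.points i - β‖ ^ 2) :
    interpolant T g β ≤ c + C * diam T ^ 2 := by
  -- The weighted vertices sum to β, so the terms in `ℓ` add up to `ℓ β` and cancel against `-ℓ β`.
  have h1 : ∀ i, (basis T).coord i β * g (T.points i) ≤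
      (basis T).coord i β * (c + C * diam T ^ 2 - ℓ β)
        + ℓ ((basis T).coord i β • T.points i) := by
    intro i
    have hd := norm_points_sub_le_diam hβ i
    have hd2 : ‖T.points i - β‖ ^ 2 ≤ diam T ^ 2 := by gcongr
    have hq := mul_le_mul_of_nonneg_left hd2 hC
    have := h i
    rw [map_sub] at this
    rw [map_smul, smul_eq_mul, ← mul_add]
    exact mul_le_mul_of_nonneg_left (by linarith) (coord_nonneg hβ i)
  calc interpolant T g β ≤ _ := Finset.sum_le_sum fun i _ => h1 i
    _ = c + C * diam T ^ 2 := by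
      rw [Finset.sum_add_distrib, ← Finset.sum_mul, sum_coord, ← map_sum, sum_coord_smul_points]
      ring

end Cell

/-! ### Reduction of the lower-level problem to the control -/

namespace BilevelProblem

variable {n : ℕ} {Y U : Type*}
  [NormedAddCommGroup Y] [InnerProductSpace ℝ Y]
  [NormedAddCommGroup U] [InnerProductSpace ℝ U]

/-- The reduced lower-level objective `(β, u) ↦ f(β, S u, u)`. -/
noncomputable def g (D : BilevelProblem n Y U) (β : Param n) (u : U) : ℝ := D.f β (D.S u) u

theorem A_eq_B_iff (D : BilevelProblem n Y U) {y : Y} {u : U} : D.A y = D.B u ↔ y = D.S u := by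
  simp only [S, ContinuousLinearMap.comp_apply, ContinuousLinearEquiv.coe_coe]
  exact D.A.eq_symm_apply.symm

theorem A_sub_B_eq_zero_iff (D : BilevelProblem n Y U) {y : Y} {u : U} :
    D.A y - D.B u = 0 ↔ y = D.S u := by
  rw [sub_eq_zero, A_eq_B_iff]

theorem φ_eq_sInf_image (D : BilevelProblem n Y U) (β : Param n) :
    D.φ β = sInf (D.g β '' D.Uad) := by
  unfold φ
  congr 1
  ext r
  constructor
  · rintro ⟨y, u, hu, h, rfl⟩
    rw [A_eq_B_iff] at h
    exact ⟨u, hu, by rw [h]; rfl⟩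
  · rintro ⟨u, hu, rfl⟩
    exact ⟨D.S u, u, hu, D.A_eq_B_iff.2 rfl, rfl⟩

namespace IsAdmissibleFunctional

variable {Q : Set (Param n)} {G : Param n → Y → U → ℝ}

theorem tendsto (hG : IsAdmissibleFunctional Q G) {ι : Type*} {l : Filter ι}
    {x : ι → Param n × Y × U} {a : Param n × Y × U} (hx : Tendsto x l (𝓝 a))
    (hxQ : ∀ i, (x i).1 ∈ Q) (ha : a.1 ∈ Q) :
    Tendsto (fun i => G (x i).1 (x i).2.1 (x i).2.2) l (𝓝 (G a.1 a.2.1 a.2.2)) :=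
  (hG.contDiff.continuousOn a ⟨ha, mem_univ _⟩).tendsto.comp
    (tendsto_nhdsWithin_iff.2 ⟨hx, Eventually.of_forall fun i => ⟨hxQ i, mem_univ _⟩⟩)

theorem hasFDerivWithinAt_param (hG : IsAdmissibleFunctional Q G) {β : Param n} (hβ : β ∈ Q)
    (y : Y) (u : U) :
    HasFDerivWithinAt (fun b => G b y u) (fderivWithin ℝ (fun b => G b y u) Q β) Q β := by
  have h := (hG.contDiff.differentiableOn one_ne_zero) (β, y, u) ⟨hβ, mem_univ _⟩
  have h2 : DifferentiableWithinAt ℝ (fun b : Param n => (b, y, u)) Q β :=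
    (differentiableAt_id.prodMk (differentiableAt_const _)).differentiableWithinAt
  have h3 : MapsTo (fun b : Param n => (b, y, u)) Q (Q ×ˢ (univ : Set (Y × U))) :=
    fun b hb => ⟨hb, mem_univ _⟩
  exact (DifferentiableWithinAt.comp (f := fun b : Param n => (b, y, u)) β h h2
    h3).hasFDerivWithinAt

end IsAdmissibleFunctional

theorem IsPolyhedron.isClosed {Q : Set (Param n)} (hQ : IsPolyhedron Q) : IsClosed Q := by
  obtain ⟨m, a, b, -, rfl⟩ := hQ
  rw [ofPred_forall]
  exact isClosed_iInter fun i => isClosed_le (by fun_prop) continuous_const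

/-! ### Lower-level stability and the value function -/

namespace StandingAssumption

variable {D : BilevelProblem n Y U}

theorem Q_isCompact (hD : D.StandingAssumption) : IsCompact D.Q :=
  Metric.isCompact_of_isClosed_isBounded (IsPolyhedron.isClosed hD.Q_polyhedron) hD.Q_bounded

theorem Q_convex (hD : D.StandingAssumption) : Convex ℝ D.Q := by
  intro a ha b hb s t hs ht hst
  have ha' : (a, (0 : Y × U)) ∈ D.Q ×ˢ (univ : Set (Y × U)) := ⟨ha, mem_univ _⟩
  have hb' : (b, (0 : Y × U)) ∈ D.Q ×ˢ (univ : Set (Y × U)) := ⟨hb, mem_univ _⟩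
  exact (hD.f_adm.convex.1 ha' hb' hs ht hst).1

theorem bddBelow_g (hD : D.StandingAssumption) {β : Param n} (hβ : β ∈ D.Q) :
    BddBelow (D.g β '' D.Uad) := by
  obtain ⟨c, hc⟩ := hD.f_adm.bounded_below
  exact ⟨c, by rintro _ ⟨u, -, rfl⟩; exact hc β hβ _ _⟩

theorem φ_le (hD : D.StandingAssumption) {β : Param n} (hβ : β ∈ D.Q) {u : U} (hu : u ∈ D.Uad) :
    D.φ β ≤ D.g β u := by
  rw [φ_eq_sInf_image]
  exact csInf_le (hD.bddBelow_g hβ) (mem_image_of_mem _ hu)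

theorem le_φ (hD : D.StandingAssumption) {β : Param n} {c : ℝ}
    (h : ∀ u ∈ D.Uad, c ≤ D.g β u) : c ≤ D.φ β := by
  rw [φ_eq_sInf_image]
  exact le_csInf (hD.Uad_nonempty.image _) (by rintro _ ⟨u, hu, rfl⟩; exact h u hu)

/-- Near-minimizers of the lower-level problem are close to each other. -/
theorem norm_sub_sq_le_of_near_minimizers (hD : D.StandingAssumption) :
    ∃ K : ℝ, ∀ β ∈ D.Q, ∀ u ∈ D.Uad, ∀ v ∈ D.Uad, ∀ δ : ℝ, D.g β u ≤ D.φ β + δ →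
      D.g β v ≤ D.φ β + δ → ‖u - v‖ ^ 2 ≤ K * δ := by
  obtain ⟨μ, hμ, h⟩ := hD.strongly_convex
  refine ⟨8 / μ, fun β hβ u hu v hv δ hu' hv' => ?_⟩
  -- Expanding at the midpoint makes the first-order terms opposite. Adding both inequalities and
  -- using g(w) ≥ φ leaves μ/4 ‖u - v‖² ≤ 2δ.
  set w : U := (1 / 2 : ℝ) • u + (1 / 2 : ℝ) • v with hw_def
  have hw : w ∈ D.Uad := hD.Uad_convex hu hv (by norm_num) (by norm_num) (by norm_num)
  have hu1 := h β hβ w hw u hu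
  have hv1 := h β hβ w hw v hv
  have e1 : u - w = (1 / 2 : ℝ) • (u - v) := by rw [hw_def]; module
  have e2 : v - w = -((1 / 2 : ℝ) • (u - v)) := by rw [hw_def]; module
  rw [e1, norm_smul] at hu1
  rw [e2, norm_neg, norm_smul, map_neg, map_neg, map_neg] at hv1
  have hφ := hD.φ_le hβ hw
  unfold g at hu' hv' hφ
  norm_num at hu1 hv1
  rw [div_mul_eq_mul_div, le_div_iff₀ hμ]
  nlinarith

/-- Near-minimizers of the lower-level problem are bounded uniformly in the parameter. -/
theorem exists_bound (hD : D.StandingAssumption) {u₀ : U} (hu₀ : u₀ ∈ D.Uad) (c : ℝ) :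
    ∃ M : ℝ, 0 ≤ M ∧ ∀ β ∈ D.Q, ∀ u ∈ D.Uad, D.g β u ≤ D.g β u₀ + c →
      ‖D.S u‖ ≤ M ∧ ‖u‖ ≤ M := by
  obtain ⟨μ, hμ, h⟩ := hD.strongly_convex
  obtain ⟨β₀, hβ₀⟩ := hD.Q_nonempty
  set M₀ := max ‖D.S u₀‖ ‖u₀‖
  have hM₀ : 0 ≤ M₀ := (norm_nonneg _).trans (le_max_right _ _)
  obtain ⟨L, hL, hlip⟩ := hD.lipschitz M₀ hM₀
  obtain ⟨R, hR⟩ := Metric.isBounded_iff.1 hD.Q_bounded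
  have hu₀' : u₀ ∈ D.Uad ∩ Metric.closedBall (0 : U) M₀ :=
    ⟨hu₀, by simp [M₀]⟩
  have hy₀' : D.S u₀ ∈ Metric.closedBall (0 : Y) M₀ := by simp [M₀]
  set Ky := ‖D.fy β₀ (D.S u₀) u₀‖ + L * R
  set Ku := ‖D.fu β₀ (D.S u₀) u₀‖ + L * R
  have hK : ∀ β ∈ D.Q, ‖D.fy β (D.S u₀) u₀‖ ≤ Ky ∧ ‖D.fu β (D.S u₀) u₀‖ ≤ Ku := by
    intro β hβ
    obtain ⟨-, -, h3, h4⟩ := hlip β hβ β hβ β₀ hβ₀ _ hy₀' _ hy₀' _ hu₀' _ hu₀' _ hu₀'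
    have hRβ : L * ‖β - β₀‖ ≤ L * R := by
      rw [← dist_eq_norm]; exact mul_le_mul_of_nonneg_left (hR hβ hβ₀) hL
    constructor
    · have := norm_le_norm_add_norm_sub' (D.fy β (D.S u₀) u₀) (D.fy β₀ (D.S u₀) u₀)
      linarith
    · have := norm_le_norm_add_norm_sub' (D.fu β (D.S u₀) u₀) (D.fu β₀ (D.S u₀) u₀)
      linarith
  have hKy0 : 0 ≤ Ky := (norm_nonneg _).trans (hK β₀ hβ₀).1
  have hKu0 : 0 ≤ Ku := (norm_nonneg _).trans (hK β₀ hβ₀).2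
  set K := Ky * ‖D.S‖ + Ku with hKdef
  have hK0 : 0 ≤ K := by positivity
  -- Strong convexity at `u₀` gives μ/2 t² ≤ K t + |c| for t = ‖u - u₀‖. The summand 1 ensures t ≥ 1
  -- when t > r, so that |c| ≤ |c| t.
  set r := 1 + 2 * (K + |c|) / μ
  have hr : 0 ≤ r := by positivity
  have key : ∀ β ∈ D.Q, ∀ u ∈ D.Uad, D.g β u ≤ D.g β u₀ + c → ‖u - u₀‖ ≤ r := by
    intro β hβ u hu hg
    have h1 := h β hβ u₀ hu₀ u hu
    obtain ⟨hy, hu'⟩ := hK β hβ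
    have b1 : |D.fy β (D.S u₀) u₀ (D.S (u - u₀))| ≤ Ky * (‖D.S‖ * ‖u - u₀‖) := by
      rw [← Real.norm_eq_abs]
      exact ((D.fy β (D.S u₀) u₀).le_opNorm _).trans
        (mul_le_mul hy (D.S.le_opNorm _) (norm_nonneg _) hKy0)
    have b2 : |D.fu β (D.S u₀) u₀ (u - u₀)| ≤ Ku * ‖u - u₀‖ := by
      rw [← Real.norm_eq_abs]
      exact ((D.fu β (D.S u₀) u₀).le_opNorm _).trans
        (mul_le_mul_of_nonneg_right hu' (norm_nonneg _))
    unfold g at hg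
    set t := ‖u - u₀‖
    have ht : 0 ≤ t := norm_nonneg _
    have h2 : μ / 2 * t ^ 2 ≤ K * t + |c| := by
      have := neg_abs_le (D.fy β (D.S u₀) u₀ (D.S (u - u₀)))
      have := neg_abs_le (D.fu β (D.S u₀) u₀ (u - u₀))
      have := le_abs_self c
      rw [hKdef]
      linarith
    by_contra! hlt
    have hr' : μ * r = μ + 2 * (K + |c|) := by
      simp only [r]; field_simp
    have ht1 : 1 ≤ t := by
      have : 1 ≤ r := by simp only [r]; linarith [show 0 ≤ 2 * (K + |c|) / μ by positivity]
      linarith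
    have h3 : |c| ≤ |c| * t := le_mul_of_one_le_right (abs_nonneg _) ht1
    have h4 : μ * r * t ≤ μ * t * t := by gcongr
    rw [hr'] at h4
    nlinarith [mul_pos hμ (zero_lt_one.trans_le ht1)]
  refine ⟨max (‖D.S‖ * (‖u₀‖ + r)) (‖u₀‖ + r), le_max_of_le_right (by positivity),
    fun β hβ u hu hg => ?_⟩
  have h1 : ‖u‖ ≤ ‖u₀‖ + r := by
    have := norm_le_norm_add_norm_sub' u u₀
    linarith [key β hβ u hu hg]
  exact ⟨le_max_of_le_left ((D.S.le_opNorm u).trans (by gcongr)), le_max_of_le_right h1⟩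

/-- A quadratic upper model of the reduced objective in the parameter, uniformly on bounded sets
of controls. -/
theorem exists_quadratic_upper_model (hD : D.StandingAssumption) {M : ℝ} (hM : 0 ≤ M) :
    ∃ L : ℝ, 0 ≤ L ∧ ∀ u ∈ D.Uad, ‖D.S u‖ ≤ M → ‖u‖ ≤ M → ∀ β ∈ D.Q, ∀ β' ∈ D.Q,
      D.g β' u ≤ D.g β u + D.fβ β (D.S u) u (β' - β) + L * ‖β' - β‖ ^ 2 := by
  obtain ⟨L, hL, hlip⟩ := hD.lipschitz M hM
  refine ⟨L, hL, fun u hu hSu hu' β hβ β' hβ' => ?_⟩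
  have huB : u ∈ D.Uad ∩ Metric.closedBall (0 : U) M := ⟨hu, by simpa using hu'⟩
  have hyB : D.S u ∈ Metric.closedBall (0 : Y) M := by simpa using hSu
  have hseg : segment ℝ β β' ⊆ D.Q := hD.Q_convex.segment_subset hβ hβ'
  -- On the segment the derivative deviates from its value at β by at most L‖β' - β‖; the mean value
  -- inequality supplies the second factor.
  have h := (convex_segment (𝕜 := ℝ) β β').norm_image_sub_le_of_norm_hasFDerivWithin_le'
    (f := fun b => D.g b u) (f' := fun b => D.fβ b (D.S u) u) (φ := D.fβ β (D.S u) u)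
    (C := L * ‖β' - β‖)
    (fun b hb => (hD.f_adm.hasFDerivWithinAt_param (hseg hb) _ _).mono hseg)
    (fun b hb => by
      have h1 := (hlip β hβ b (hseg hb) β hβ _ hyB _ hyB _ huB _ huB _ huB).1
      have h2 : ‖b - β‖ ≤ ‖β' - β‖ := by
        obtain ⟨s, t, hs, ht, hst, rfl⟩ := hb
        have : s • β + t • β' - β = t • (β' - β) := by
          obtain rfl : s = 1 - t := by linarith
          module
        rw [this, norm_smul, Real.norm_of_nonneg ht]
        exact mul_le_of_le_one_left (norm_nonneg _) (by linarith)
      simp only [sub_self, norm_zero, add_zero] at h1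
      exact h1.trans (mul_le_mul_of_nonneg_left h2 hL))
    (left_mem_segment ℝ β β') (right_mem_segment ℝ β β')
  have := (le_abs_self _).trans h
  nlinarith

/-- The reduced objective is Lipschitz in the parameter, uniformly on bounded sets of controls. -/
theorem exists_lipschitz_param (hD : D.StandingAssumption) {M : ℝ} (hM : 0 ≤ M) :
    ∃ C : ℝ, ∀ u ∈ D.Uad, ‖D.S u‖ ≤ M → ‖u‖ ≤ M → ∀ β ∈ D.Q, ∀ β' ∈ D.Q,
      D.g β' u ≤ D.g β u + C * ‖β' - β‖ := by
  obtain ⟨L, hL, hlip⟩ := hD.lipschitz M hM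
  obtain ⟨R, hR⟩ := Metric.isBounded_iff.1 hD.Q_bounded
  obtain ⟨β₀, hβ₀⟩ := hD.Q_nonempty
  by_cases hne : ∃ u₀ ∈ D.Uad, ‖D.S u₀‖ ≤ M ∧ ‖u₀‖ ≤ M
  swap
  · exact ⟨0, fun u hu h1 h2 => absurd ⟨u, hu, h1, h2⟩ hne⟩
  obtain ⟨u₀, hu₀, hSu₀, hu₀'⟩ := hne
  have huB₀ : u₀ ∈ D.Uad ∩ Metric.closedBall (0 : U) M := ⟨hu₀, by simpa using hu₀'⟩
  have hyB₀ : D.S u₀ ∈ Metric.closedBall (0 : Y) M := by simpa using hSu₀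
  -- A bound for the derivative: its value at one reference point, plus L times the largest
  -- variation of β, y and u.
  refine ⟨‖D.fβ β₀ (D.S u₀) u₀‖ + L * (R + (M + M) + (M + M)),
    fun u hu hSu hu' β hβ β' hβ' => ?_⟩
  have huB : u ∈ D.Uad ∩ Metric.closedBall (0 : U) M := ⟨hu, by simpa using hu'⟩
  have hyB : D.S u ∈ Metric.closedBall (0 : Y) M := by simpa using hSu
  have h := hD.Q_convex.norm_image_sub_le_of_norm_hasFDerivWithin_le
    (f := fun b => D.g b u) (f' := fun b => D.fβ b (D.S u) u)
    (C := ‖D.fβ β₀ (D.S u₀) u₀‖ + L * (R + (M + M) + (M + M)))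
    (fun b hb => hD.f_adm.hasFDerivWithinAt_param hb _ _)
    (fun b hb => by
      have h1 := (hlip β hβ b hb β₀ hβ₀ _ hyB _ hyB₀ _ huB _ huB _ huB₀).1
      have h2 : ‖b - β₀‖ ≤ R := by rw [← dist_eq_norm]; exact hR hb hβ₀
      have h3 : ‖D.S u - D.S u₀‖ ≤ M + M := (norm_sub_le _ _).trans (add_le_add hSu hSu₀)
      have h4 : ‖u - u₀‖ ≤ M + M := (norm_sub_le _ _).trans (add_le_add hu' hu₀')
      have h5 := norm_le_norm_add_norm_sub' (D.fβ b (D.S u) u) (D.fβ β₀ (D.S u₀) u₀)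
      have h6 := mul_le_mul_of_nonneg_left (add_le_add (add_le_add h2 h3) h4) hL
      linarith)
    hβ hβ'
  have := (le_abs_self _).trans h
  linarith

theorem continuous_g (hD : D.StandingAssumption) {β : Param n} (hβ : β ∈ D.Q) :
    Continuous (D.g β) := by
  refine continuous_iff_continuousAt.2 fun u => ?_
  exact hD.f_adm.tendsto (l := 𝓝 u) (x := fun v => (β, D.S v, v)) (a := (β, D.S u, u))
    (Continuous.tendsto (f := fun v => (β, D.S v, v)) (by fun_prop) u) (fun _ => hβ) hβ

/-- The lower-level problem has a solution. -/
theorem exists_minimizer [CompleteSpace U] (hD : D.StandingAssumption) {β : Param n}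
    (hβ : β ∈ D.Q) : ∃ u ∈ D.Uad, D.g β u = D.φ β := by
  obtain ⟨K, hK⟩ := hD.norm_sub_sq_le_of_near_minimizers
  have h1 : ∀ k : ℕ, ∃ u ∈ D.Uad, D.g β u < D.φ β + 1 / ((k : ℝ) + 1) := by
    intro k
    have hlt : sInf (D.g β '' D.Uad) < D.φ β + 1 / ((k : ℝ) + 1) := by
      rw [← φ_eq_sInf_image]
      linarith [Nat.one_div_pos_of_nat (α := ℝ) (n := k)]
    obtain ⟨_, ⟨u, hu, rfl⟩, h⟩ := exists_lt_of_csInf_lt (hD.Uad_nonempty.image _) hlt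
    exact ⟨u, hu, h⟩
  choose v hv hvlt using h1
  have hlim : Tendsto (fun k : ℕ => 1 / ((k : ℝ) + 1)) atTop (𝓝 0) :=
    tendsto_one_div_add_atTop_nhds_zero_nat
  have hcauchy : CauchySeq v := by
    refine cauchySeq_of_le_tendsto_0 (fun N : ℕ => √(K * (1 / ((N : ℝ) + 1)))) ?_ ?_
    · intro i j N hi hj
      rw [dist_eq_norm]
      refine Real.le_sqrt_of_sq_le (hK β hβ _ (hv i) _ (hv j) _ ?_ ?_)
      · linarith [hvlt i, Nat.one_div_le_one_div (α := ℝ) hi]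
      · linarith [hvlt j, Nat.one_div_le_one_div (α := ℝ) hj]
    · have := (hlim.const_mul K).sqrt
      simpa using this
  obtain ⟨u, hu⟩ := cauchySeq_tendsto_of_complete hcauchy
  have huad : u ∈ D.Uad := hD.Uad_closed.mem_of_tendsto hu (Eventually.of_forall hv)
  refine ⟨u, huad, le_antisymm ?_ (hD.φ_le hβ huad)⟩
  refine le_of_tendsto_of_tendsto' (((hD.continuous_g hβ).tendsto u).comp hu)
    (by simpa using tendsto_const_nhds.add hlim) fun k => (hvlt k).le

/-- The optimal-value function is convex. -/
theorem convexOn_φ [CompleteSpace U] (hD : D.StandingAssumption) : ConvexOn ℝ D.Q D.φ := by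
  refine ⟨hD.Q_convex, fun a ha b hb s t hs ht hst => ?_⟩
  obtain ⟨u, hu, hu'⟩ := hD.exists_minimizer ha
  obtain ⟨v, hv, hv'⟩ := hD.exists_minimizer hb
  -- `f` is jointly convex and `S` linear, so combined minimizers compete at the combined parameter.
  have h := hD.f_adm.convex.2 (x := (a, D.S u, u)) ⟨ha, mem_univ _⟩ (y := (b, D.S v, v))
    ⟨hb, mem_univ _⟩ hs ht hst
  have h2 := hD.φ_le (hD.Q_convex ha hb hs ht hst) (hD.Uad_convex hu hv hs ht hst)
  unfold g at h2 hu' hv'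
  rw [map_add, map_smul, map_smul] at h2
  rw [← hu', ← hv']
  exact h2.trans h

/-- The interpolation error of the optimal-value function is quadratic in the diameter. -/
theorem exists_interpolant_le [CompleteSpace U] (hD : D.StandingAssumption) :
    ∃ C : ℝ, 0 ≤ C ∧ ∀ T : Cell n, T.closedInterior ⊆ D.Q → ∀ β ∈ T.closedInterior,
      Cell.interpolant T D.φ β ≤ D.φ β + C * Cell.diam T ^ 2 := by
  obtain ⟨u₀, hu₀⟩ := hD.Uad_nonempty
  obtain ⟨M, hM, hbd⟩ := hD.exists_bound hu₀ 0
  obtain ⟨L, hL, hup⟩ := hD.exists_quadratic_upper_model hM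
  refine ⟨L, hL, fun T hT β hβ => ?_⟩
  obtain ⟨u, hu, hmin⟩ := hD.exists_minimizer (hT hβ)
  obtain ⟨h1, h2⟩ := hbd β (hT hβ) u hu (by rw [hmin, add_zero]; exact hD.φ_le (hT hβ) hu₀)
  -- The minimizer at β is kept as a competitor at every vertex; its uniform bound makes `L`
  -- independent of T and β.
  refine Cell.interpolant_le hβ hL (D.fβ β (D.S u) u) fun i => ?_
  have hi := hT (T.point_mem_closedInterior i)
  rw [← hmin]
  exact (hD.φ_le hi hu).trans (hup u hu h1 h2 β (hT hβ) _ hi)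

theorem ovrFeasible_nonempty [CompleteSpace U] (hD : D.StandingAssumption) :
    D.ovrFeasible.Nonempty := by
  obtain ⟨β, hβ⟩ := hD.Q_nonempty
  obtain ⟨u, hu, hmin⟩ := hD.exists_minimizer hβ
  exact ⟨(β, D.S u, u), hβ, hmin.le, D.A_sub_B_eq_zero_iff.2 rfl, hu⟩

/-- A sequence of lower-level feasible points whose optimality gap tends to zero has a convergent
subsequence. -/
theorem exists_tendsto_subseq [CompleteSpace U] (hD : D.StandingAssumption)
    {x : ℕ → Param n × Y × U} (hQ : ∀ k, (x k).1 ∈ D.Q) (hS : ∀ k, (x k).2.1 = D.S (x k).2.2)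
    (hU : ∀ k, (x k).2.2 ∈ D.Uad) {δ : ℕ → ℝ} (hδ : Tendsto δ atTop (𝓝 0))
    (hgap : ∀ k, D.g (x k).1 (x k).2.2 ≤ D.φ (x k).1 + δ k) :
    ∃ (s : ℕ → ℕ) (a : Param n × Y × U), StrictMono s ∧ Tendsto (x ∘ s) atTop (𝓝 a) := by
  obtain ⟨β, hβ, s, hs, hlim⟩ := hD.Q_isCompact.tendsto_subseq hQ
  obtain ⟨u, hu, hmin⟩ := hD.exists_minimizer hβ
  obtain ⟨c, hc⟩ := hδ.bddAbove_range
  have hc' : ∀ k, δ k ≤ |c| := fun k => (hc (mem_range_self k)).trans (le_abs_self c)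
  obtain ⟨M, hM, hbd⟩ := hD.exists_bound hu |c|
  obtain ⟨C, hC⟩ := hD.exists_lipschitz_param hM
  obtain ⟨K, hK⟩ := hD.norm_sub_sq_le_of_near_minimizers
  obtain ⟨hSuM, huM⟩ := hbd β hβ u hu (by linarith [abs_nonneg c])
  -- The parameter is changed twice: for the iterate's control towards β, and for the limit
  -- minimizer `u` back from it.
  set ε : ℕ → ℝ := fun j => |δ (s j)| + 2 * |C| * ‖(x (s j)).1 - β‖
  have hβlim : Tendsto (fun j => ‖(x (s j)).1 - β‖) atTop (𝓝 0) :=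
    tendsto_iff_norm_sub_tendsto_zero.1 hlim
  have hε : Tendsto ε atTop (𝓝 0) := by
    have := ((hδ.comp hs.tendsto_atTop).abs).add (hβlim.const_mul (2 * |C|))
    simpa using this
  have hε0 : ∀ j, 0 ≤ ε j := fun j => by positivity
  have hsq : ∀ j, ‖(x (s j)).2.2 - u‖ ^ 2 ≤ K * ε j := by
    intro j
    refine hK β hβ _ (hU _) _ hu _ ?_ (by linarith [hε0 j])
    have h1 := (hgap (s j)).trans (add_le_add_left (hD.φ_le (hQ (s j)) hu) _)
    obtain ⟨h2, h3⟩ := hbd _ (hQ (s j)) _ (hU (s j)) (by linarith [hc' (s j)])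
    have h4 := hC _ (hU (s j)) h2 h3 _ (hQ (s j)) β hβ
    have h5 := hC u hu hSuM huM β hβ _ (hQ (s j))
    rw [norm_sub_rev] at h4
    have h6 := mul_le_mul_of_nonneg_right (le_abs_self C) (norm_nonneg ((x (s j)).1 - β))
    have h7 := le_abs_self (δ (s j))
    simp only [ε]
    linarith
  have hulim : Tendsto (fun j => (x (s j)).2.2) atTop (𝓝 u) := by
    rw [tendsto_iff_norm_sub_tendsto_zero]
    refine squeeze_zero (fun _ => norm_nonneg _) (fun j => Real.le_sqrt_of_sq_le (hsq j)) ?_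
    simpa using (hε.const_mul K).sqrt
  refine ⟨s, (β, D.S u, u), hs, ?_⟩
  have hylim : Tendsto (fun j => (x (s j)).2.1) atTop (𝓝 (D.S u)) := by
    simp only [hS]
    exact (D.S.continuous.tendsto u).comp hulim
  exact hlim.prodMk_nhds (hylim.prodMk_nhds hulim)

/-- Limits of lower-level feasible points whose optimality gap tends to zero are feasible. -/
theorem mem_ovrFeasible_of_tendsto (hD : D.StandingAssumption)
    {x : ℕ → Param n × Y × U} (hQ : ∀ k, (x k).1 ∈ D.Q) (hS : ∀ k, (x k).2.1 = D.S (x k).2.2)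
    (hU : ∀ k, (x k).2.2 ∈ D.Uad) {δ : ℕ → ℝ} (hδ : Tendsto δ atTop (𝓝 0))
    (hgap : ∀ k, D.g (x k).1 (x k).2.2 ≤ D.φ (x k).1 + δ k) {a : Param n × Y × U}
    (ha : Tendsto x atTop (𝓝 a)) : a ∈ D.ovrFeasible := by
  have h1 : Tendsto (fun k => (x k).1) atTop (𝓝 a.1) := ha.fst_nhds
  have h2 : Tendsto (fun k => (x k).2.1) atTop (𝓝 a.2.1) := ha.snd_nhds.fst_nhds
  have h3 : Tendsto (fun k => (x k).2.2) atTop (𝓝 a.2.2) := ha.snd_nhds.snd_nhds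
  have haQ : a.1 ∈ D.Q := hD.Q_isCompact.isClosed.mem_of_tendsto h1 (Eventually.of_forall hQ)
  have haU : a.2.2 ∈ D.Uad := hD.Uad_closed.mem_of_tendsto h3 (Eventually.of_forall hU)
  have haS : a.2.1 = D.S a.2.2 := by
    simp only [hS] at h2
    exact tendsto_nhds_unique h2 ((D.S.continuous.tendsto _).comp h3)
  refine ⟨haQ, hD.le_φ fun u hu => ?_, D.A_sub_B_eq_zero_iff.2 haS, haU⟩
  -- Comparing with a fixed control `u` avoids any need for continuity of `φ`.
  have hr : Tendsto (fun k => D.g (x k).1 u + δ k) atTop (𝓝 (D.g a.1 u)) := by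
    have := (hD.f_adm.tendsto (x := fun k => ((x k).1, D.S u, u)) (a := (a.1, D.S u, u))
      (h1.prodMk_nhds tendsto_const_nhds) hQ haQ).add hδ
    rwa [add_zero] at this
  refine le_of_tendsto_of_tendsto' (hD.f_adm.tendsto ha hQ haQ) hr fun k => ?_
  rw [hS k]
  exact (hgap k).trans (add_le_add_left (hD.φ_le (hQ k) hu) _)

end StandingAssumption

/-! ### Penalty estimates along a run -/

namespace IsPenaltyRun

variable {D : BilevelProblem n Y U} {P : ℝ → ℝ} {q ρ : ℝ} {𝒯 : ℕ → Set (Cell n)}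
  {γ : ℕ → Cell n → ℝ} {z : ℕ → Cell n → Param n × Y × U} {Tbar : ℕ → Cell n}

/-- The cells of every iteration cover exactly `Q`. -/
theorem iUnion_closedInterior (hrun : D.IsPenaltyRun P q ρ 𝒯 γ z Tbar) (k : ℕ) :
    ⋃ T ∈ 𝒯 k, T.closedInterior = D.Q := by
  induction k with
  | zero => exact hrun.init_subdivision.2
  | succ k ih =>
    obtain ⟨R, hR, -, hk⟩ := hrun.refine_cell k
    rw [hk, biUnion_union, hR.2, ← ih]
    conv_rhs => rw [← insert_eq_of_mem (hrun.Tbar_mem k), ← insert_sdiff_singleton,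
      biUnion_insert]
    exact union_comm _ _

theorem closedInterior_subset (hrun : D.IsPenaltyRun P q ρ 𝒯 γ z Tbar) {k : ℕ} {T : Cell n}
    (hT : T ∈ 𝒯 k) : T.closedInterior ⊆ D.Q := by
  rw [← hrun.iUnion_closedInterior k]
  exact subset_biUnion_of_mem (u := fun T : Cell n => T.closedInterior) hT

theorem iterate_mem (hrun : D.IsPenaltyRun P q ρ 𝒯 γ z Tbar) (k : ℕ) :
    (z k (Tbar k)).1 ∈ D.Q ∧ (z k (Tbar k)).2.1 = D.S (z k (Tbar k)).2.2 ∧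
      (z k (Tbar k)).2.2 ∈ D.Uad := by
  obtain ⟨⟨h1, h2, h3⟩, -⟩ := hrun.solves k _ (hrun.Tbar_mem k)
  exact ⟨hrun.closedInterior_subset (hrun.Tbar_mem k) h1, D.A_sub_B_eq_zero_iff.1 h2, h3⟩

/-- The selected penalty value is a lower bound for the optimal value of (OVR). -/
theorem penaltyObjective_le [CompleteSpace U] (hrun : D.IsPenaltyRun id q ρ 𝒯 γ z Tbar)
    (hD : D.StandingAssumption) (k : ℕ) {x : Param n × Y × U} (hx : x ∈ D.ovrFeasible) :
    D.penaltyObjective id (Tbar k) (γ k (Tbar k)) (z k (Tbar k)) ≤ D.F x.1 x.2.1 x.2.2 := by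
  obtain ⟨hxQ, hxf, hxA, hxU⟩ := hx
  have hmem := hxQ
  rw [← hrun.iUnion_closedInterior k] at hmem
  obtain ⟨T, hT, hxT⟩ := mem_iUnion₂.1 hmem
  have h1 := hrun.Tbar_argmin k T hT
  have h2 := (hrun.solves k T hT).2 x ⟨hxT, hxA, hxU⟩
  have h3 := Cell.le_interpolant hD.convexOn_φ (hrun.closedInterior_subset hT) hxT
  have h4 : γ k T * (D.f x.1 x.2.1 x.2.2 - Cell.interpolant T D.φ x.1) ≤ 0 :=
    mul_nonpos_of_nonneg_of_nonpos (hrun.γ_pos k T hT).le (by linarith)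
  refine h1.trans (h2.trans ?_)
  unfold penaltyObjective
  simp only [id]
  linarith

/-- The penalized optimality gap at the iterates is controlled by the interpolation error. -/
theorem exists_F_add_gap_le [CompleteSpace U] (hrun : D.IsPenaltyRun id q ρ 𝒯 γ z Tbar)
    (hD : D.StandingAssumption) :
    ∃ C : ℝ, ∀ k, ∀ x ∈ D.ovrFeasible,
      D.F (z k (Tbar k)).1 (z k (Tbar k)).2.1 (z k (Tbar k)).2.2
        + γ k (Tbar k) * (D.g (z k (Tbar k)).1 (z k (Tbar k)).2.2 - D.φ (z k (Tbar k)).1)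
      ≤ D.F x.1 x.2.1 x.2.2 + C * (γ k (Tbar k) * Cell.diam (Tbar k) ^ 2) := by
  obtain ⟨C, -, hC⟩ := hD.exists_interpolant_le
  refine ⟨C, fun k x hx => ?_⟩
  have h1 := hrun.penaltyObjective_le hD k hx
  have h2 := hC _ (hrun.closedInterior_subset (hrun.Tbar_mem k)) _
    (hrun.solves k _ (hrun.Tbar_mem k)).1.1
  have h3 := mul_le_mul_of_nonneg_left h2 (hrun.γ_pos k _ (hrun.Tbar_mem k)).le
  have h4 := (hrun.iterate_mem k).2.1
  unfold penaltyObjective at h1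
  simp only [id] at h1
  rw [g, ← h4]
  linarith

/-- The optimality gap at the iterates tends to zero. -/
theorem exists_gap_bound [CompleteSpace U] (hrun : D.IsPenaltyRun id q ρ 𝒯 γ z Tbar)
    (hD : D.StandingAssumption) (hγ : Tendsto (fun k => γ k (Tbar k)) atTop atTop)
    (hγdiam : Tendsto (fun k => γ k (Tbar k) * Cell.diam (Tbar k) ^ 2) atTop (𝓝 0)) :
    ∃ δ : ℕ → ℝ, Tendsto δ atTop (𝓝 0) ∧ ∀ k,
      D.g (z k (Tbar k)).1 (z k (Tbar k)).2.2 ≤ D.φ (z k (Tbar k)).1 + δ k := by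
  obtain ⟨C, hC⟩ := hrun.exists_F_add_gap_le hD
  obtain ⟨x, hx⟩ := hD.ovrFeasible_nonempty
  obtain ⟨c, hc⟩ := hD.F_adm.bounded_below
  -- With F ≥ c the penalized estimate is solved for the gap: a convergent numerator over γ → ∞.
  refine ⟨fun k => (D.F x.1 x.2.1 x.2.2 - c + C * (γ k (Tbar k) * Cell.diam (Tbar k) ^ 2))
    / γ k (Tbar k), (tendsto_const_nhds.add (hγdiam.const_mul C)).div_atTop hγ, fun k => ?_⟩
  have h1 := hC k x hx
  have h2 := hc _ (hrun.iterate_mem k).1 (z k (Tbar k)).2.1 (z k (Tbar k)).2.2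
  rw [← sub_le_iff_le_add', le_div_iff₀ (hrun.γ_pos k _ (hrun.Tbar_mem k))]
  linarith

/-- Limits of subsequences of the iterates solve (OVR). -/
theorem isOVRSolution_of_tendsto [CompleteSpace U] (hrun : D.IsPenaltyRun id q ρ 𝒯 γ z Tbar)
    (hD : D.StandingAssumption) (hγ : Tendsto (fun k => γ k (Tbar k)) atTop atTop)
    (hγdiam : Tendsto (fun k => γ k (Tbar k) * Cell.diam (Tbar k) ^ 2) atTop (𝓝 0))
    {s : ℕ → ℕ} (hs : Tendsto s atTop atTop) {a : Param n × Y × U}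
    (ha : Tendsto (fun j => z (s j) (Tbar (s j))) atTop (𝓝 a)) : D.IsOVRSolution a := by
  obtain ⟨δ, hδ, hgap⟩ := hrun.exists_gap_bound hD hγ hγdiam
  have hfeas : a ∈ D.ovrFeasible := hD.mem_ovrFeasible_of_tendsto
    (fun j => (hrun.iterate_mem (s j)).1) (fun j => (hrun.iterate_mem (s j)).2.1)
    (fun j => (hrun.iterate_mem (s j)).2.2) (hδ.comp hs) (fun j => hgap (s j)) ha
  refine ⟨hfeas, fun x hx => ?_⟩
  obtain ⟨C, hC⟩ := hrun.exists_F_add_gap_le hD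
  have hr : Tendsto (fun j => D.F x.1 x.2.1 x.2.2
      + C * (γ (s j) (Tbar (s j)) * Cell.diam (Tbar (s j)) ^ 2)) atTop
      (𝓝 (D.F x.1 x.2.1 x.2.2)) := by
    simpa using tendsto_const_nhds.add ((hγdiam.comp hs).const_mul C)
  refine le_of_tendsto_of_tendsto'
    (hD.F_adm.tendsto ha (fun j => (hrun.iterate_mem (s j)).1) hfeas.1) hr fun j => ?_
  have h1 := hD.φ_le (hrun.iterate_mem (s j)).1 (hrun.iterate_mem (s j)).2.2
  have h2 := mul_nonneg (hrun.γ_pos (s j) _ (hrun.Tbar_mem (s j))).le (sub_nonneg.2 h1)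
  linarith [hC (s j) x hx]

/-- Every subsequence of the iterates has a convergent subsequence. -/
theorem exists_tendsto_subseq [CompleteSpace U] (hrun : D.IsPenaltyRun id q ρ 𝒯 γ z Tbar)
    (hD : D.StandingAssumption) (hγ : Tendsto (fun k => γ k (Tbar k)) atTop atTop)
    (hγdiam : Tendsto (fun k => γ k (Tbar k) * Cell.diam (Tbar k) ^ 2) atTop (𝓝 0))
    {t : ℕ → ℕ} (ht : Tendsto t atTop atTop) :
    ∃ (s : ℕ → ℕ) (a : Param n × Y × U), StrictMono s ∧
      Tendsto (fun j => z (t (s j)) (Tbar (t (s j)))) atTop (𝓝 a) := by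
  obtain ⟨δ, hδ, hgap⟩ := hrun.exists_gap_bound hD hγ hγdiam
  exact hD.exists_tendsto_subseq (x := fun j => z (t j) (Tbar (t j)))
    (fun j => (hrun.iterate_mem (t j)).1) (fun j => (hrun.iterate_mem (t j)).2.1)
    (fun j => (hrun.iterate_mem (t j)).2.2) (hδ.comp ht) (fun j => hgap (t j))

end IsPenaltyRun

end BilevelProblem

end InverseControl

/-! ### Convergence of the iterates -/

theorem mainTheorem8 {n : ℕ} {Y U : Type*}
    [NormedAddCommGroup Y] [InnerProductSpace ℝ Y] [CompleteSpace Y]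
    [NormedAddCommGroup U] [InnerProductSpace ℝ U] [CompleteSpace U]
    (D : InverseControl.BilevelProblem n Y U) (hD : D.StandingAssumption)
    (q ρ : ℝ) (𝒯 : ℕ → Set (InverseControl.Cell n)) (γ : ℕ → InverseControl.Cell n → ℝ)
    (z : ℕ → InverseControl.Cell n → InverseControl.Param n × Y × U)
    (Tbar : ℕ → InverseControl.Cell n)
    (hrun : D.IsPenaltyRun id q ρ 𝒯 γ z Tbar)
    (hγ : Tendsto (fun k => γ k (Tbar k)) atTop atTop)
    (hγdiam : Tendsto (fun k => γ k (Tbar k) * InverseControl.Cell.diam (Tbar k) ^ 2)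
      atTop (𝓝 0)) :
    (∃ (s : ℕ → ℕ) (x : InverseControl.Param n × Y × U), StrictMono s ∧
      Tendsto (fun j => z (s j) (Tbar (s j))) atTop (𝓝 x)) ∧
    (∀ x : InverseControl.Param n × Y × U,
      MapClusterPt x atTop (fun k => z k (Tbar k)) → D.IsOVRSolution x) ∧
    (∀ x : InverseControl.Param n × Y × U,
      D.IsOVRSolution x → (∀ x', D.IsOVRSolution x' → x' = x) →
        Tendsto (fun k => z k (Tbar k)) atTop (𝓝 x)) := by
  refine ⟨hrun.exists_tendsto_subseq hD hγ hγdiam tendsto_id, fun x hx => ?_,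
    fun x _ huniq => ?_⟩
  · obtain ⟨s, hs, hlim⟩ := hx.tendsto_subseq
    exact hrun.isOVRSolution_of_tendsto hD hγ hγdiam hs.tendsto_atTop hlim
  · refine tendsto_of_subseq_tendsto fun t ht => ?_
    obtain ⟨s, a, hs, hlim⟩ := hrun.exists_tendsto_subseq hD hγ hγdiam ht
    have ha := hrun.isOVRSolution_of_tendsto hD hγ hγdiam (ht.comp hs.tendsto_atTop) hlim
    exact ⟨s, huniq a ha ▸ hlim⟩
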